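/- Let $\alpha,\beta,w\in\mathbb{R}$ with $0<\alpha<1$, $\beta>0$ and $w\neq 0$, and let $$g(x)=\frac{1-e^{2\pi w}e^{2\pi i x}}{x-iw}\in L^2(\mathbb{R}),\qquad g_{m,n}(x)=e^{2\pi i\beta m x}\,g(x-\alpha n)\quad(m,n\in\mathbb{Z}).$$ The series $\sum_{m\in\mathbb{Z}}e^{2\pi i m\beta x}$ converges unconditionally in the space $\mathcal{S}'(\mathbb{R})$ of tempered distributions (with the topology of pointwise convergence on Schwartz functions); let $$h_3(x)=\frac{-1+e^{4\pi w}e^{2\pi i x}}{x-2iw}\sum_{m\in\mathbb{Z}}e^{2\pi i m\beta x}\in\mathcal{S}'(\mathbb{R})$$ be its product with the smooth bounded function $\frac{-1+e^{4\pi w}e^{2\pi i x}}{x-2iw}$. Then the frame operator $$Sf=\sum_{m,n\in\mathbb{Z}}(f,g_{m,n})\,g_{m,n},\qquad (f,h)=\int_{\mathbb{R}}f\,\overline{h},$$ is well defined and bounded on $L^2(\mathbb{R})$, where the series converges unconditionally in $L^2(\mathbb{R})$ for every $f\in L^2(\mathbb{R})$, and it is a single convolution on a dense subspace: for every Schwartz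 function $f$ (in particular for every $f\in C_0^\infty(\mathbb{R})$), $$Sf=-\frac{2\pi i}{\alpha}\; f*h_3\quad\text{almost everywhere},\qquad\text{where } (f*h_3)(x)=\langle h_3,\,f(x-\cdot)\rangle .$$ -/

import Mathlib

open MeasureTheory Complex
open scoped SchwartzMap ComplexConjugate ENNReal

noncomputable section

/-! ### Gabor systems and frame operators -/

/-- The time-frequency shift of `g` by `(a, b)`: the function `t ↦ e^{2πi b t} g (t - a)`. -/
def timeFreqShift (a b : ℝ) (g : ℝ → ℂ) : ℝ → ℂ :=
  fun t => cexp (2 * Real.pi * I * b * t) * g (t - a)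

theorem memLp_timeFreqShift (a b : ℝ) {g : ℝ → ℂ} (hg : MemLp g 2 volume) :
    MemLp (timeFreqShift a b g) 2 volume := by
  have h1 : MemLp (fun t => g (t - a)) 2 volume :=
    hg.comp_measurePreserving (measurePreserving_sub_right volume a)
  have hc : Continuous fun t : ℝ => cexp (2 * Real.pi * I * b * t) := by fun_prop
  refine MemLp.of_le h1 (hc.aestronglyMeasurable.mul h1.1) (Filter.Eventually.of_forall fun t => ?_)
  have : (2 * Real.pi * I * b * t : ℂ) = ((2 * Real.pi * b * t : ℝ) : ℂ) * I := by
    push_cast; ring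
  simp only [timeFreqShift, norm_mul, this, norm_exp_ofReal_mul_I, one_mul, le_refl]

/-- The element `g_{m,n} (t) = e^{2πi β m t} g (t - α n)` of the Gabor system with window `g` over
the lattice `αℤ × βℤ`, as an element of `L²(ℝ)`; the index is `p = (m, n)`. -/
def gaborAtom (g : ℝ → ℂ) (hg : MemLp g 2 volume) (α β : ℝ) (p : ℤ × ℤ) :
    Lp ℂ 2 (volume : Measure ℝ) :=
  (memLp_timeFreqShift (α * p.2) (β * p.1) hg).toLp _

/-- `S` is the frame operator of the Gabor system with window `g` over `αℤ × βℤ`: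
`S f = ∑_{m,n} (f, g_{m,n}) g_{m,n}`, with unconditional convergence in `L²(ℝ)`, for all `f` in
`L²(ℝ)`. Here `(f, h) = ∫ f \bar h`; in Mathlib this is `inner ℂ h f`. -/
def IsGaborFrameOperator (g : ℝ → ℂ) (hg : MemLp g 2 volume) (α β : ℝ)
    (S : Lp ℂ 2 (volume : Measure ℝ) →L[ℂ] Lp ℂ 2 (volume : Measure ℝ)) : Prop :=
  ∀ f : Lp ℂ 2 (volume : Measure ℝ),
    HasSum (fun p : ℤ × ℤ => inner ℂ (gaborAtom g hg α β p) f • gaborAtom g hg α β p) (S f)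

/-! ### The window -/

/-- The window `g(x) = (1 - e^{2πw} e^{2πix}) / (x - iw)`. -/
def sincWindow (w : ℝ) (x : ℝ) : ℂ :=
  (1 - cexp (2 * Real.pi * w) * cexp (2 * Real.pi * I * x)) / (x - I * w)

theorem ofReal_sub_I_mul_ne_zero {w : ℝ} (hw : w ≠ 0) (x : ℝ) : (x - I * w : ℂ) ≠ 0 := by
  intro h
  have := congrArg Complex.im h
  simp at this
  exact hw this

theorem memLp_sincWindow {w : ℝ} (hw : w ≠ 0) : MemLp (sincWindow w) 2 volume := by
  have hcont : Continuous (sincWindow w) := by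
    unfold sincWindow
    exact Continuous.div (by fun_prop) (by fun_prop) (ofReal_sub_I_mul_ne_zero hw)
  rw [memLp_two_iff_integrable_sq_norm hcont.aestronglyMeasurable]
  have h1 : Integrable (fun x : ℝ => (1 + (x / w) ^ 2)⁻¹) volume :=
    integrable_inv_one_add_sq.comp_div hw
  refine (h1.const_mul ((1 + Real.exp (2 * Real.pi * w)) ^ 2 / w ^ 2)).mono'
    (by fun_prop) (Filter.Eventually.of_forall fun x => ?_)
  have hnum : ‖(1 - cexp (2 * Real.pi * w) * cexp (2 * Real.pi * I * x) : ℂ)‖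
      ≤ 1 + Real.exp (2 * Real.pi * w) := by
    refine (norm_sub_le _ _).trans ?_
    have e1 : (2 * Real.pi * w : ℂ) = ((2 * Real.pi * w : ℝ) : ℂ) := by push_cast; ring
    have e2 : (2 * Real.pi * I * x : ℂ) = ((2 * Real.pi * x : ℝ) : ℂ) * I := by push_cast; ring
    rw [norm_mul, e1, e2, norm_exp_ofReal_mul_I, norm_exp_ofReal]
    simp
  have hden : ‖(x - I * w : ℂ)‖ ^ 2 = w ^ 2 * (1 + (x / w) ^ 2) := by
    rw [← normSq_eq_norm_sq, normSq_apply]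
    simp
    field_simp
    ring
  rw [Real.norm_of_nonneg (by positivity), sincWindow, norm_div, div_pow, hden]
  have hpos : 0 < 1 + (x / w) ^ 2 := by positivity
  have hw2 : 0 < w ^ 2 := by positivity
  calc _ ≤ (1 + Real.exp (2 * Real.pi * w)) ^ 2 / (w ^ 2 * (1 + (x / w) ^ 2)) := by gcongr
    _ = _ := by field_simp

/-! ### The distribution `h₃` and convolution with it -/

/-- The function `x ↦ e^{2πi ξ x}`. -/
def expWave (ξ : ℝ) (x : ℝ) : ℂ := cexp (2 * Real.pi * I * ξ * x)

theorem hasTemperateGrowth_expWave (ξ : ℝ) : (expWave ξ).HasTemperateGrowth := by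
  have hsm : ContDiff ℝ (⊤ : ℕ∞) (expWave ξ) :=
    (contDiff_const.mul ofRealCLM.contDiff).cexp
  refine ⟨hsm, fun n => ⟨0, ‖(2 * Real.pi * I * ξ : ℂ)‖ ^ n, fun x => ?_⟩⟩
  have key : ∀ n : ℕ, iteratedDeriv n (expWave ξ)
      = fun x : ℝ => (2 * Real.pi * I * ξ : ℂ) ^ n * expWave ξ x := by
    intro n
    induction n with
    | zero => simp
    | succ k ih =>
      rw [iteratedDeriv_succ, ih]
      funext y
      have h0 : HasDerivAt (fun z : ℝ => (2 * Real.pi * I * ξ : ℂ) * z)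
          (2 * Real.pi * I * ξ : ℂ) y := by
        simpa using (ofRealCLM.hasDerivAt (x := y)).const_mul (2 * Real.pi * I * ξ : ℂ)
      have h1 := (h0.cexp.const_mul ((2 * Real.pi * I * ξ : ℂ) ^ k)).deriv
      unfold expWave
      rw [h1]
      ring
  have e : (2 * Real.pi * I * ξ * x : ℂ) = ((2 * Real.pi * ξ * x : ℝ) : ℂ) * I := by
    push_cast; ring
  rw [norm_iteratedFDeriv_eq_norm_iteratedDeriv, key, norm_mul, norm_pow, expWave, e,
    norm_exp_ofReal_mul_I]
  simp

/-- The tempered distribution `φ ↦ ∫ φ(x) e^{2πi ξ x} dx`. -/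
def expWaveDist (ξ : ℝ) : 𝓢'(ℝ, ℂ) :=
  (hasTemperateGrowth_expWave ξ).toTemperedDistribution volume

/-- The tempered distribution `∑_{m ∈ ℤ} e^{2πi m β x}`. -/
def expSeries (β : ℝ) : 𝓢'(ℝ, ℂ) := ∑' m : ℤ, expWaveDist (m * β)

/-- The function `x ↦ (-1 + e^{4πw} e^{2πix}) / (x - 2iw)`. -/
def sincKernel (w : ℝ) (x : ℝ) : ℂ :=
  (-1 + cexp (4 * Real.pi * w) * cexp (2 * Real.pi * I * x)) / (x - 2 * I * w)

/-- The function `sincKernel w` is of temperate growth, so it may multiply tempered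
distributions. -/
theorem hasTemperateGrowth_sincKernel {w : ℝ} (hw : w ≠ 0) :
    (sincKernel w).HasTemperateGrowth := by
  have hlin : (fun x : ℝ => (1 / (2 * w)) * x).HasTemperateGrowth :=
    (Function.HasTemperateGrowth.const _).mul Function.HasTemperateGrowth.id'
  have hr : (fun x : ℝ => (1 + ‖(1 / (2 * w)) * x‖ ^ 2) ^ (-1 : ℝ)).HasTemperateGrowth :=
    (Function.hasTemperateGrowth_one_add_norm_sq_rpow ℝ (-1)).comp hlin
  have hrc : (fun x : ℝ => (((1 + ‖(1 / (2 * w)) * x‖ ^ 2) ^ (-1 : ℝ) : ℝ) : ℂ)).HasTemperateGrowth :=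
    Function.Complex.hasTemperateGrowth_ofReal.comp hr
  have hE : (fun x : ℝ => (-1 + cexp (4 * Real.pi * w) * expWave 1 x)).HasTemperateGrowth :=
    (Function.HasTemperateGrowth.const _).add
      ((Function.HasTemperateGrowth.const _).mul (hasTemperateGrowth_expWave 1))
  have hx : (fun x : ℝ => (1 / (4 * w ^ 2) : ℂ) * ((x : ℂ) + 2 * I * w)).HasTemperateGrowth :=
    (Function.HasTemperateGrowth.const _).mul
      (Function.Complex.hasTemperateGrowth_ofReal.add (Function.HasTemperateGrowth.const _))
  have hmain := (hE.mul hx).mul hrc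
  suffices heq : sincKernel w = ((fun x : ℝ => (-1 + cexp (4 * Real.pi * w) * expWave 1 x)) *
      (fun x : ℝ => (1 / (4 * w ^ 2) : ℂ) * ((x : ℂ) + 2 * I * w))) *
      (fun x : ℝ => (((1 + ‖(1 / (2 * w)) * x‖ ^ 2) ^ (-1 : ℝ) : ℝ) : ℂ)) by
    rw [heq]; exact hmain
  funext x
  have hwc : (w : ℂ) ≠ 0 := by exact_mod_cast hw
  have hne : (x - 2 * I * w : ℂ) ≠ 0 := by
    have := ofReal_sub_I_mul_ne_zero (w := 2 * w) (by simpa using hw) x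
    intro h
    apply this
    push_cast
    linear_combination h
  have hne' : (x + 2 * I * w : ℂ) ≠ 0 := by
    have := ofReal_sub_I_mul_ne_zero (w := -(2 * w)) (by simpa using hw) x
    intro h
    apply this
    push_cast
    linear_combination h
  have hprod : (4 * w ^ 2 + x ^ 2 : ℂ) = (x - 2 * I * w) * (x + 2 * I * w) := by
    linear_combination (4 * (w : ℂ) ^ 2) * I_sq
  have hrr : (1 + ‖(1 / (2 * w)) * x‖ ^ 2) ^ (-1 : ℝ) = 4 * w ^ 2 / (4 * w ^ 2 + x ^ 2) := by
    rw [Real.rpow_neg_one, Real.norm_eq_abs, sq_abs]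
    have : 0 < 4 * w ^ 2 + x ^ 2 := by positivity
    field_simp
    ring
  simp only [Pi.mul_apply]
  rw [hrr]
  push_cast
  rw [hprod]
  simp only [sincKernel, expWave, ofReal_one, mul_one]
  generalize (x - 2 * I * w : ℂ) = A at hne ⊢
  generalize (x + 2 * I * w : ℂ) = B at hne' ⊢
  field_simp

/-- The tempered distribution
`h₃(x) = (-1 + e^{4πw} e^{2πix}) / (x - 2iw) · ∑_{m ∈ ℤ} e^{2πi m β x}`. -/
def hThree (w β : ℝ) : 𝓢'(ℝ, ℂ) :=
  TemperedDistribution.smulLeftCLM ℂ (sincKernel w) (expSeries β)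

/-- The Schwartz function `s ↦ f (x - s)`. -/
def reflectShift (f : 𝓢(ℝ, ℂ)) (x : ℝ) : 𝓢(ℝ, ℂ) :=
  SchwartzMap.compCLMOfContinuousLinearEquiv ℂ (ContinuousLinearEquiv.neg ℝ)
    (SchwartzMap.compSubConstCLM ℂ (-x) f)

theorem reflectShift_apply (f : 𝓢(ℝ, ℂ)) (x s : ℝ) : reflectShift f x s = f (x - s) := by
  simp [reflectShift, sub_eq_add_neg, add_comm]

/-- The convolution `(f * T)(x) = ⟨T, f(x - ·)⟩` of a Schwartz function with a tempered
distribution. -/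
def schwartzConv (f : 𝓢(ℝ, ℂ)) (T : 𝓢'(ℝ, ℂ)) (x : ℝ) : ℂ := T (reflectShift f x)

end

/-! This is the "painless" situation on the Fourier side. The transform of the window is $\hat
g(\xi)=-2\pi i\,e^{2\pi w\xi}$ on $(0,1]$ and zero elsewhere. As $\alpha<1$, each translate $\hat
g(\cdot-\beta m)$ is supported in an interval of length $1/\alpha$, on which the exponentials
$e^{2\pi i\alpha n\xi}$ form a complete orthogonal system. Parseval for fixed $m$
(`hasSum_sq_inner_freqAtom`) shows that the sum over $n$ acts as multiplication by $|\hat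
g(\xi-\beta m)|^2/\alpha$.

The square $|\hat g|^2=4\pi^2e^{4\pi w\xi}$ on $(0,1]$ is again a truncated exponential
(`truncExp_four_pi`). So the multiplier for $m$ is the transform of $-(2\pi i/\alpha)\,e^{2\pi
i\beta mx}$ times `sincKernel w`, and row $m$ of the frame operator is convolution with that
function. Summing over $m$ produces $h_3$.

Two convergence facts complete the argument. At most $\beta^{-1}+1$ translates overlap at a point,
which gives a Bessel bound, hence a bounded frame operator and unconditional convergence in $L^2$.
The sum over $m$ also converges at every $x$, because the exponential series converges in $\mathcal
S'$; `ae_eq_of_hasSum_Lp` identifies the two limits. -/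

open FourierTransform

/-! ### Bessel sequences in Hilbert spaces -/

section Bessel

variable {ι H : Type*} [NormedAddCommGroup H] [InnerProductSpace ℂ H]

/-- `g` is a Bessel sequence with bound `B`. -/
def IsBesselWith (g : ι → H) (B : ℝ) : Prop :=
  0 ≤ B ∧ ∀ (f : H) (s : Finset ι), ∑ i ∈ s, ‖inner ℂ (g i) f‖ ^ 2 ≤ B * ‖f‖ ^ 2

/-- Duality: pair the sum $v$ with itself, apply Cauchy–Schwarz and the Bessel bound at $v$, then
cancel $\|v\|^2$. -/
theorem IsBesselWith.norm_sum_smul_sq_le {g : ι → H} {B : ℝ} (hg : IsBesselWith g B)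
    (c : ι → ℂ) (s : Finset ι) :
    ‖∑ i ∈ s, c i • g i‖ ^ 2 ≤ B * ∑ i ∈ s, ‖c i‖ ^ 2 := by
  obtain ⟨hB, hg⟩ := hg
  set v := ∑ i ∈ s, c i • g i with hv
  rcases eq_or_ne v 0 with h0 | h0
  · rw [h0]
    simp only [norm_zero, ne_eq, OfNat.ofNat_ne_zero, not_false_eq_true, zero_pow]
    positivity
  have h1 : ‖v‖ ^ 2 ≤ ∑ i ∈ s, ‖c i‖ * ‖inner ℂ (g i) v‖ := by
    have : ‖inner ℂ v v‖ = ‖v‖ ^ 2 := by rw [inner_self_eq_norm_sq_to_K]; simp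
    rw [← this]
    nth_rewrite 2 [hv]
    rw [inner_sum]
    refine (norm_sum_le _ _).trans (Finset.sum_le_sum fun i _ => ?_)
    rw [inner_smul_right, norm_mul, norm_inner_symm]
  have h2 : (‖v‖ ^ 2) ^ 2 ≤ (B * ∑ i ∈ s, ‖c i‖ ^ 2) * ‖v‖ ^ 2 := calc
    (‖v‖ ^ 2) ^ 2 ≤ (∑ i ∈ s, ‖c i‖ * ‖inner ℂ (g i) v‖) ^ 2 := by gcongr
    _ ≤ (∑ i ∈ s, ‖c i‖ ^ 2) * ∑ i ∈ s, ‖inner ℂ (g i) v‖ ^ 2 :=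
      Finset.sum_mul_sq_le_sq_mul_sq _ _ _
    _ ≤ (∑ i ∈ s, ‖c i‖ ^ 2) * (B * ‖v‖ ^ 2) := by gcongr; exact hg v s
    _ = _ := by ring
  have h3 : 0 < ‖v‖ ^ 2 := by positivity
  rw [sq (‖v‖ ^ 2)] at h2
  exact le_of_mul_le_mul_right h2 h3

theorem IsBesselWith.summable_sq {g : ι → H} {B : ℝ} (hg : IsBesselWith g B) (f : H) :
    Summable fun i => ‖inner ℂ (g i) f‖ ^ 2 :=
  summable_of_sum_le (fun _ => by positivity) (hg.2 f)

theorem IsBesselWith.summable_smul [CompleteSpace H] {g : ι → H} {B : ℝ} (hg : IsBesselWith g B)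
    {c : ι → ℂ} (hc : Summable fun i => ‖c i‖ ^ 2) : Summable fun i => c i • g i := by
  rw [summable_iff_vanishing_norm] at hc ⊢
  intro ε hε
  have hB1 : 0 < B + 1 := by linarith [hg.1]
  -- `B + 1` replaces `B` in the tolerance because `B` may vanish.
  obtain ⟨s, hs⟩ := hc (ε ^ 2 / (B + 1)) (by positivity)
  refine ⟨s, fun t ht => ?_⟩
  have h1 := hs t ht
  rw [Real.norm_of_nonneg (Finset.sum_nonneg fun _ _ => by positivity)] at h1
  have h2 := hg.norm_sum_smul_sq_le c t
  refine lt_of_pow_lt_pow_left₀ 2 hε.le (h2.trans_lt ?_)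
  rw [lt_div_iff₀ hB1] at h1
  have : 0 ≤ ∑ i ∈ t, ‖c i‖ ^ 2 := Finset.sum_nonneg fun _ _ => by positivity
  nlinarith

/-- The frame operator of a Bessel sequence is well defined and bounded. -/
theorem IsBesselWith.exists_frameOperator [CompleteSpace H] {g : ι → H} {B : ℝ}
    (hg : IsBesselWith g B) :
    ∃ S : H →L[ℂ] H, ∀ f, HasSum (fun i => inner ℂ (g i) f • g i) (S f) := by
  have hs : ∀ f, Summable fun i => inner ℂ (g i) f • g i := fun f =>
    hg.summable_smul (hg.summable_sq f)
  let S₀ : H →ₗ[ℂ] H :=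
    { toFun := fun f => ∑' i, inner ℂ (g i) f • g i
      map_add' := fun f f' => by
        rw [← (hs f).tsum_add (hs f')]
        simp only [inner_add_right, add_smul]
      map_smul' := fun a f => by
        rw [RingHom.id_apply, ← (hs f).tsum_const_smul]
        simp only [inner_smul_right, smul_smul] }
  refine ⟨S₀.mkContinuous B fun f => ?_, fun f => (hs f).hasSum⟩
  -- The bound passes to the limit from partial sums, whose squared norms are at most $B\cdot
  -- B\|f\|^2$: one factor from synthesis, one from analysis.
  refine le_of_tendsto (hs f).hasSum.norm (Filter.Eventually.of_forall fun s => ?_)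
  refine le_of_sq_le_sq ?_ (mul_nonneg hg.1 (norm_nonneg f))
  refine (hg.norm_sum_smul_sq_le _ s).trans ?_
  rw [mul_pow, sq B, mul_assoc]
  exact mul_le_mul_of_nonneg_left (hg.2 f s) hg.1

/-- If `∑ |⟨g i, f⟩|² = ⟨f, D f⟩` for all `f`, then `D` is the frame operator of `g`. -/
theorem hasSum_inner_smul_of_hasSum_sq [CompleteSpace H] {g : ι → H} (D : H →L[ℂ] H)
    (h : ∀ f, HasSum (fun i => ((‖inner ℂ (g i) f‖ ^ 2 : ℝ) : ℂ)) (inner ℂ f (D f))) (f : H) :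
    HasSum (fun i => inner ℂ (g i) f • g i) (D f) := by
  have hB : IsBesselWith g ‖D‖ := by
    refine ⟨norm_nonneg _, fun f s => ?_⟩
    have h1 := Complex.hasSum_re (h f)
    simp only [ofReal_re] at h1
    calc _ ≤ (inner ℂ f (D f)).re := sum_le_hasSum s (fun _ _ => by positivity) h1
      _ ≤ ‖inner ℂ f (D f)‖ := Complex.re_le_norm _
      _ ≤ ‖f‖ * ‖D f‖ := norm_inner_le_norm _ _
      _ ≤ ‖f‖ * (‖D‖ * ‖f‖) := by gcongr; exact D.le_opNorm f
      _ = _ := by ring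
  obtain ⟨S, hS⟩ := hB.exists_frameOperator
  -- Over ℂ an operator is determined by its quadratic form, by polarization.
  have hSD : (S : H →ₗ[ℂ] H) = D := by
    refine (ext_inner_map _ _).1 fun x => ?_
    have h2 := (hS x).mapL (innerSL ℂ x)
    simp only [innerSL_apply_apply, inner_smul_right] at h2
    have h3 : inner ℂ x (S x) = inner ℂ x (D x) := by
      refine h2.unique ?_
      have h4 : (fun i => inner ℂ (g i) x * inner ℂ x (g i))
          = fun i => ((‖inner ℂ (g i) x‖ ^ 2 : ℝ) : ℂ) := by
        funext i
        rw [← inner_conj_symm x (g i), mul_conj, normSq_eq_norm_sq]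
      rw [h4]
      exact h x
    rw [ContinuousLinearMap.coe_coe, ContinuousLinearMap.coe_coe, ← inner_conj_symm, h3,
      inner_conj_symm]
  have : S f = D f := congrArg (fun T : H →ₗ[ℂ] H => T f) hSD
  rw [← this]
  exact hS f

end Bessel

/-! ### The exponential series and convolution with `h₃` -/

theorem expWaveDist_apply (ξ : ℝ) (φ : 𝓢(ℝ, ℂ)) :
    expWaveDist ξ φ = ∫ x, φ x * expWave ξ x := by
  simp [expWaveDist, Function.HasTemperateGrowth.toTemperedDistribution_apply]

theorem expWaveDist_eq_fourier (ξ : ℝ) (φ : 𝓢(ℝ, ℂ)) : expWaveDist ξ φ = 𝓕 φ (-ξ) := by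
  rw [expWaveDist_apply, SchwartzMap.fourier_coe, Real.fourier_eq']
  refine integral_congr_ae (Filter.Eventually.of_forall fun x => ?_)
  simp only [expWave, smul_eq_mul]
  rw [mul_comm]
  congr 2
  simp
  ring

theorem summable_int_mul_sq_inv {β : ℝ} (hβ : 0 < β) :
    Summable fun m : ℤ => ((1 + |(m : ℝ) * β|) ^ 2)⁻¹ := by
  have h := (Real.summable_one_div_int_pow (p := 2)).2 (by norm_num)
  refine Summable.of_norm_bounded_eventually (h.mul_left (β ^ 2)⁻¹) ?_
  -- At `m = 0` the majorant takes the value `1 / 0 = 0` and the comparison fails; a cofinite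
  -- comparison is enough.
  have : ∀ᶠ m : ℤ in Filter.cofinite, m ≠ 0 := by
    simpa using (Set.finite_singleton (0 : ℤ)).compl_mem_cofinite
  filter_upwards [this] with m hm
  have hm' : (m : ℝ) ≠ 0 := by exact_mod_cast hm
  rw [Real.norm_of_nonneg (by positivity), one_div, ← mul_inv]
  gcongr
  rw [← sq_abs (m : ℝ), ← mul_pow, abs_mul, abs_of_pos hβ]
  gcongr
  linarith [mul_comm β |(m : ℝ)|]

/-- Quadratic decay suffices to sum over a lattice. The index `(2, 0)` means two powers of $x$ and
no derivatives; control by seminorms gives continuity of `combDist`. -/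
theorem SchwartzMap.norm_le_inv_mul_seminorm (φ : 𝓢(ℝ, ℂ)) (x : ℝ) :
    ‖φ x‖ ≤ 2 ^ 2 * (((Finset.Iic (2, 0)).sup
      (schwartzSeminormFamily ℂ ℝ ℂ)) φ) * ((1 + |x|) ^ 2)⁻¹ := by
  have := SchwartzMap.one_add_le_sup_seminorm_apply (𝕜 := ℂ) (m := (2, 0)) (k := 2) (n := 0)
    le_rfl le_rfl φ x
  rw [norm_iteratedFDeriv_zero, Real.norm_eq_abs] at this
  rw [← div_eq_mul_inv, le_div_iff₀ (by positivity), mul_comm]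
  exact this

theorem SchwartzMap.summable_norm_int_mul (φ : 𝓢(ℝ, ℂ)) {β : ℝ} (hβ : 0 < β) :
    Summable fun m : ℤ => ‖φ (-(m * β))‖ := by
  refine Summable.of_nonneg_of_le (fun _ => norm_nonneg _)
    (fun m => φ.norm_le_inv_mul_seminorm (-(m * β))) (Summable.mul_left _ ?_)
  simpa only [abs_neg] using summable_int_mul_sq_inv hβ

/-- The tempered distribution `φ ↦ ∑_{m ∈ ℤ} φ (-m β)`. -/
noncomputable def combDist {β : ℝ} (hβ : 0 < β) : 𝓢(ℝ, ℂ) →L[ℂ] ℂ :=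
  SchwartzMap.mkCLMtoNormedSpace (fun φ => ∑' m : ℤ, φ (-(m * β)))
    (fun φ ψ => (φ.summable_norm_int_mul hβ).of_norm.tsum_add
      (ψ.summable_norm_int_mul hβ).of_norm)
    (fun a φ => by
      simp only [smul_apply, smul_eq_mul, tsum_mul_left, RingHom.id_apply])
    ⟨Finset.Iic (2, 0), 2 ^ 2 * ∑' m : ℤ, ((1 + |(m : ℝ) * β|) ^ 2)⁻¹, by positivity, fun φ => by
      have h : ∀ m : ℤ, ‖φ (-(m * β))‖ ≤ 2 ^ 2 * (((Finset.Iic (2, 0)).sup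
          (schwartzSeminormFamily ℂ ℝ ℂ)) φ) * ((1 + |(m : ℝ) * β|) ^ 2)⁻¹ := fun m => by
        simpa using φ.norm_le_inv_mul_seminorm (-(m * β))
      refine (norm_tsum_le_tsum_norm (φ.summable_norm_int_mul hβ)).trans ?_
      refine ((φ.summable_norm_int_mul hβ).tsum_le_tsum h
        ((summable_int_mul_sq_inv hβ).mul_left _)).trans_eq ?_
      rw [tsum_mul_left]
      ring⟩

/-- Tested on $\varphi$, the series is $\sum_m\hat\varphi(-m\beta)$, so its sum is `combDist`
composed with the Fourier transform, a continuous functional. -/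
theorem summable_expWaveDist {β : ℝ} (hβ : 0 < β) :
    Summable fun m : ℤ => expWaveDist (m * β) := by
  let T : 𝓢'(ℝ, ℂ) := ((combDist hβ).comp (fourierCLM ℂ 𝓢(ℝ, ℂ)) : 𝓢(ℝ, ℂ) →L[ℂ] ℂ)
  refine ⟨T, ?_⟩
  rw [HasSum, PointwiseConvergenceCLM.tendsto_iff_forall_tendsto]
  intro φ
  have h := ((𝓕 φ).summable_norm_int_mul hβ).of_norm.hasSum
  rw [HasSum] at h
  refine h.congr fun s => ?_
  rw [sum_apply]
  exact Finset.sum_congr rfl fun m _ => (expWaveDist_eq_fourier _ φ).symm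

/-- Convergence in $\mathcal S'$ is tested on one Schwartz function, `sincKernel w` times
$f(x-\cdot)$; this holds at every $x$, not only almost everywhere. -/
theorem hasSum_schwartzConv_hThree {w β : ℝ} (hw : w ≠ 0) (hβ : 0 < β) (f : 𝓢(ℝ, ℂ)) (x : ℝ) :
    HasSum (fun m : ℤ => ∫ s, sincKernel w s * f (x - s) * expWave (m * β) s)
      (schwartzConv f (hThree w β) x) := by
  have h := (summable_expWaveDist hβ).hasSum
  rw [HasSum, PointwiseConvergenceCLM.tendsto_iff_forall_tendsto] at h
  have h2 := h (SchwartzMap.smulLeftCLM ℂ (sincKernel w) (reflectShift f x))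
  refine h2.congr fun s => ?_
  rw [sum_apply]
  refine Finset.sum_congr rfl fun m _ => ?_
  rw [expWaveDist_apply]
  simp only [SchwartzMap.smulLeftCLM_apply_apply (hasTemperateGrowth_sincKernel hw),
    reflectShift_apply, smul_eq_mul]

/-! ### The inverse Fourier transform -/

theorem expWave_add (a b x : ℝ) : expWave (a + b) x = expWave a x * expWave b x := by
  simp only [expWave, ← Complex.exp_add]
  congr 1
  push_cast
  ring

theorem expWave_comm (a b : ℝ) : expWave a b = expWave b a := by
  simp only [expWave]
  congr 1
  ring

theorem expWave_add_right (a x y : ℝ) : expWave a (x + y) = expWave a x * expWave a y := by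
  simp only [expWave_comm a, expWave_add]

theorem norm_expWave (a x : ℝ) : ‖expWave a x‖ = 1 := by
  have e : (2 * Real.pi * I * a * x : ℂ) = ((2 * Real.pi * a * x : ℝ) : ℂ) * I := by
    push_cast; ring
  rw [expWave, e, norm_exp_ofReal_mul_I]

theorem continuous_expWave (a : ℝ) : Continuous (expWave a) := by
  unfold expWave
  fun_prop

theorem fourierInv_eq_integral_expWave (φ : ℝ → ℂ) (x : ℝ) :
    𝓕⁻ φ x = ∫ ξ, expWave x ξ * φ ξ := by
  rw [Real.fourierInv_eq']
  refine integral_congr_ae (Filter.Eventually.of_forall fun ξ => ?_)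
  simp only [expWave, smul_eq_mul]
  congr 2
  simp
  ring

theorem fourier_eq_integral_expWave (φ : ℝ → ℂ) (x : ℝ) :
    𝓕 φ x = ∫ ξ, expWave (-x) ξ * φ ξ := by
  rw [← fourierInv_eq_integral_expWave, Real.fourierInv_eq_fourier_neg, neg_neg]

theorem integral_fourierInv_mul_eq_of_integrable {φ ψ : ℝ → ℂ} (hφ : Integrable φ)
    (hψ : Integrable ψ) : ∫ x, 𝓕⁻ φ x * ψ x = ∫ x, φ x * 𝓕⁻ ψ x := by
  have h : ∫ x, 𝓕 φ x * ψ (-x) = ∫ x, φ x * 𝓕 (fun y => ψ (-y)) x := by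
    simpa using! VectorFourier.integral_fourierIntegral_smul_eq_flip (L := innerₗ ℝ)
      Real.continuous_fourierChar continuous_inner hφ hψ.comp_neg
  rw [Real.fourierInv_eq_fourier_comp_neg ψ, ← h, ← integral_neg_eq_self]
  simp only [Real.fourierInv_eq_fourier_neg, neg_neg]

theorem continuous_fourierInv {φ : ℝ → ℂ} (hφ : Integrable φ) : Continuous (𝓕⁻ φ) := by
  rw [Real.fourierInv_eq_fourier_comp_neg]
  exact VectorFourier.fourierIntegral_continuous (L := innerₗ ℝ) Real.continuous_fourierChar
    continuous_inner hφ.comp_neg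

/-- On `L¹ ∩ L²` the inverse Fourier transform on `L²` is given by the integral. -/
theorem coeFn_fourierInv_toLp {φ : ℝ → ℂ} (h1 : Integrable φ) (h2 : MemLp φ 2) :
    (𝓕⁻ (h2.toLp φ) : Lp ℂ 2 (volume : Measure ℝ)) =ᵐ[volume] 𝓕⁻ φ := by
  refine ae_eq_of_integral_contDiff_smul_eq
    ((Lp.memLp _).locallyIntegrable (by norm_num))
    (continuous_fourierInv h1).locallyIntegrable fun g hg hgc => ?_
  have hg₁ : HasCompactSupport (Complex.ofRealCLM ∘ g) := hgc.comp_left rfl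
  have hg₂ : ContDiff ℝ (⊤ : ℕ∞) (Complex.ofRealCLM ∘ g) := Complex.ofRealCLM.contDiff.comp hg
  set ψ : 𝓢(ℝ, ℂ) := hg₁.toSchwartzMap hg₂ with hψ
  have hψg : ∀ x, ψ x = (g x : ℂ) := fun x => by simp [hψ]
  -- The $L^2$ transform agrees with the distributional one, which by definition moves onto the test
  -- function; the $L^1$ multiplication formula moves it back.
  have h3 := congrArg (fun T : 𝓢'(ℝ, ℂ) => T ψ)
    (Lp.fourierInv_toTemperedDistribution_eq (h2.toLp φ))
  simp only [TemperedDistribution.fourierInv_apply, Lp.toTemperedDistribution_apply,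
    smul_eq_mul] at h3
  simp only [Complex.real_smul]
  simp only [hψg] at h3
  rw [← h3]
  have h4 : ∫ x, (𝓕⁻ ψ) x * (h2.toLp φ) x = ∫ x, 𝓕⁻ (⇑ψ) x * φ x := by
    refine integral_congr_ae ?_
    filter_upwards [h2.coeFn_toLp] with x hx
    rw [hx, SchwartzMap.fourierInv_coe]
  rw [h4, integral_fourierInv_mul_eq_of_integrable ψ.integrable h1]
  simp only [hψg]

/-! ### The window on the Fourier side -/

/-- The function `ξ ↦ c e^{aξ}` on `(0, 1]`, extended by zero. -/
noncomputable def truncExp (c : ℂ) (a : ℝ) : ℝ → ℂ :=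
  (Set.Ioc (0 : ℝ) 1).indicator fun ξ => c * cexp (a * ξ)

theorem measurable_truncExp (c : ℂ) (a : ℝ) : Measurable (truncExp c a) :=
  Measurable.indicator (by fun_prop) measurableSet_Ioc

theorem norm_truncExp_le (c : ℂ) (a ξ : ℝ) :
    ‖truncExp c a ξ‖ ≤ (Set.Ioc (0 : ℝ) 1).indicator (fun _ => ‖c‖ * Real.exp |a|) ξ := by
  rw [truncExp, norm_indicator_eq_indicator_norm]
  refine Set.indicator_le_indicator' fun hξ => ?_
  rw [norm_mul, ← ofReal_mul, norm_exp_ofReal]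
  gcongr
  calc a * ξ ≤ |a| * ξ := mul_le_mul_of_nonneg_right (le_abs_self a) hξ.1.le
    _ ≤ |a| * 1 := by gcongr; exact hξ.2
    _ = |a| := mul_one _

theorem memLp_truncExp (c : ℂ) (a : ℝ) (p : ℝ≥0∞) : MemLp (truncExp c a) p volume := by
  have h : MemLp ((Set.Ioc (0 : ℝ) 1).indicator fun _ => ‖c‖ * Real.exp |a|) p volume :=
    memLp_indicator_const p measurableSet_Ioc _ (Or.inr (by simp))
  exact h.of_le (measurable_truncExp c a).aestronglyMeasurable
    (Filter.Eventually.of_forall fun ξ => (norm_truncExp_le c a ξ).trans (Real.le_norm_self _))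

theorem fourierInv_truncExp (c : ℂ) {a : ℝ} (ha : a ≠ 0) (y : ℝ) :
    𝓕⁻ (truncExp c a) y = c * ((cexp (a + 2 * Real.pi * I * y) - 1) / (a + 2 * Real.pi * I * y)) := by
  have hne : (a + 2 * Real.pi * I * y : ℂ) ≠ 0 := by
    intro h
    apply ha
    simpa using congrArg Complex.re h
  rw [fourierInv_eq_integral_expWave]
  have h1 : ∀ ξ, expWave y ξ * truncExp c a ξ = (Set.Ioc (0 : ℝ) 1).indicator
      (fun ξ : ℝ => c * cexp ((a + 2 * Real.pi * I * y) * ξ)) ξ := fun ξ => by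
    by_cases hξ : ξ ∈ Set.Ioc (0 : ℝ) 1
    · simp only [truncExp, Set.indicator_of_mem hξ, expWave]
      rw [mul_left_comm, ← Complex.exp_add]
      congr 2
      ring
    · simp only [truncExp, Set.indicator_of_notMem hξ, mul_zero]
  simp only [h1]
  rw [integral_indicator measurableSet_Ioc, ← intervalIntegral.integral_of_le zero_le_one,
    intervalIntegral.integral_const_mul, integral_exp_mul_complex hne]
  simp

theorem fourierInv_comp_sub (φ : ℝ → ℂ) (b x : ℝ) :
    𝓕⁻ (fun ξ => φ (ξ - b)) x = expWave b x * 𝓕⁻ φ x := by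
  rw [fourierInv_eq_integral_expWave, fourierInv_eq_integral_expWave, ← integral_const_mul,
    ← integral_add_right_eq_self _ b]
  refine integral_congr_ae (Filter.Eventually.of_forall fun ξ => ?_)
  simp only [add_sub_cancel_right]
  rw [expWave_add_right, expWave_comm x b]
  ring

theorem fourierInv_expWave_mul (φ : ℝ → ℂ) (a x : ℝ) :
    𝓕⁻ (fun ξ => expWave (-a) ξ * φ ξ) x = 𝓕⁻ φ (x - a) := by
  rw [fourierInv_eq_integral_expWave, fourierInv_eq_integral_expWave]
  simp only [sub_eq_add_neg, expWave_add, mul_assoc]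

/-- The denominator $2\pi w+2\pi iy$ factors as $2\pi i(y-iw)$, and the constant $-2\pi i$ cancels
the factor and fixes the sign. -/
theorem fourierInv_truncExp_eq_sincWindow {w : ℝ} (hw : w ≠ 0) (y : ℝ) :
    𝓕⁻ (truncExp (-(2 * Real.pi * I)) (2 * Real.pi * w)) y = sincWindow w y := by
  have hne := ofReal_sub_I_mul_ne_zero hw y
  have hpi : (2 * Real.pi * I : ℂ) ≠ 0 := by simp [Real.pi_ne_zero]
  rw [fourierInv_truncExp _ (by positivity)]
  have h1 : (((2 * Real.pi * w : ℝ) : ℂ) + 2 * Real.pi * I * y) = 2 * Real.pi * I * (y - I * w) := by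
    push_cast
    linear_combination (2 * Real.pi * w : ℂ) * I_sq
  rw [sincWindow, ← Complex.exp_add]
  have h2 : (2 * Real.pi * w + 2 * Real.pi * I * y : ℂ) = 2 * Real.pi * I * (y - I * w) := by
    rw [← h1]; push_cast; ring
  rw [h1, h2]
  field_simp
  ring

theorem fourierInv_truncExp_eq_sincKernel {w : ℝ} (hw : w ≠ 0) (c : ℂ) (y : ℝ) :
    𝓕⁻ (truncExp (2 * Real.pi * I * c) (4 * Real.pi * w)) y = c * sincKernel w y := by
  have hne : (y - 2 * I * w : ℂ) ≠ 0 := by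
    have := ofReal_sub_I_mul_ne_zero (w := 2 * w) (by simpa using hw) y
    push_cast at this
    rwa [← mul_assoc, mul_comm I 2] at this
  have hpi : (2 * Real.pi * I : ℂ) ≠ 0 := by simp [Real.pi_ne_zero]
  rw [fourierInv_truncExp _ (by positivity)]
  have h1 : (((4 * Real.pi * w : ℝ) : ℂ) + 2 * Real.pi * I * y)
      = 2 * Real.pi * I * (y - 2 * I * w) := by
    push_cast
    linear_combination (4 * Real.pi * w : ℂ) * I_sq
  rw [sincKernel, ← Complex.exp_add]
  have h2 : (4 * Real.pi * w + 2 * Real.pi * I * y : ℂ) = 2 * Real.pi * I * (y - 2 * I * w) := by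
    rw [← h1]; push_cast; ring
  rw [h1, h2]
  field_simp
  ring

/-- The Fourier transform of `gaborAtom (sincWindow w) _ α β p`. -/
noncomputable def freqAtom (w α β : ℝ) (p : ℤ × ℤ) (ξ : ℝ) : ℂ :=
  expWave (-(α * p.2)) (ξ - β * p.1) *
    truncExp (-(2 * Real.pi * I)) (2 * Real.pi * w) (ξ - β * p.1)

theorem memLp_freqAtom (w α β : ℝ) (p : ℤ × ℤ) (q : ℝ≥0∞) :
    MemLp (freqAtom w α β p) q volume := by
  have h := (memLp_truncExp (-(2 * Real.pi * I)) (2 * Real.pi * w) q).comp_measurePreserving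
    (measurePreserving_sub_right volume (β * p.1))
  refine MemLp.of_le h ?_ (Filter.Eventually.of_forall fun ξ => ?_)
  · exact ((continuous_expWave _).comp
      (continuous_id.sub continuous_const)).aestronglyMeasurable.mul h.1
  · simp [freqAtom, norm_expWave]

theorem fourierInv_freqAtom {w : ℝ} (hw : w ≠ 0) (α β : ℝ) (p : ℤ × ℤ) :
    𝓕⁻ (freqAtom w α β p) = timeFreqShift (α * p.2) (β * p.1) (sincWindow w) := by
  funext x
  have h := fourierInv_comp_sub (fun ξ => expWave (-(α * p.2)) ξ *
    truncExp (-(2 * Real.pi * I)) (2 * Real.pi * w) ξ) (β * p.1) x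
  rw [fourierInv_expWave_mul, fourierInv_truncExp_eq_sincWindow hw] at h
  exact h

theorem fourierInv_toLp_freqAtom {w : ℝ} (hw : w ≠ 0) (α β : ℝ) (p : ℤ × ℤ) :
    𝓕⁻ ((memLp_freqAtom w α β p 2).toLp _) =
      gaborAtom (sincWindow w) (memLp_sincWindow hw) α β p := by
  refine Lp.ext ?_
  have h := coeFn_fourierInv_toLp (memLp_one_iff_integrable.1 (memLp_freqAtom w α β p 1))
    (memLp_freqAtom w α β p 2)
  rw [fourierInv_freqAtom hw] at h
  exact h.trans (MemLp.coeFn_toLp _).symm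

/-! ### Parseval's identity for the atoms on the Fourier side -/

theorem integral_norm_sq_eq_norm_sq (φ : Lp ℂ 2 (volume : Measure ℝ)) :
    ∫ ξ, ‖φ ξ‖ ^ 2 = ‖φ‖ ^ 2 := by
  have h : inner ℂ φ φ = ((∫ ξ, ‖φ ξ‖ ^ 2 : ℝ) : ℂ) := by
    rw [L2.inner_def, ← integral_complex_ofReal]
    refine integral_congr_ae (Filter.Eventually.of_forall fun ξ => ?_)
    simp only [inner_self_eq_norm_sq_to_K]
    simp
  rw [inner_self_eq_norm_sq_to_K] at h
  have h' : ((‖φ‖ ^ 2 : ℝ) : ℂ) = ((∫ ξ, ‖φ ξ‖ ^ 2 : ℝ) : ℂ) := by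
    rw [← h, ofReal_pow]
    rfl
  exact (Complex.ofReal_injective h').symm

theorem integrable_norm_sq (φ : Lp ℂ 2 (volume : Measure ℝ)) :
    Integrable fun ξ => ‖φ ξ‖ ^ 2 :=
  (memLp_two_iff_integrable_sq_norm (Lp.memLp φ).1).1 (Lp.memLp φ)

/-- The multiplier `|ĝ(ξ - b)|² / α`. -/
noncomputable def freqMultiplier (w α b : ℝ) (ξ : ℝ) : ℝ :=
  α⁻¹ * ‖truncExp (-(2 * Real.pi * I)) (2 * Real.pi * w) (ξ - b)‖ ^ 2

theorem conj_expWave (a x : ℝ) : conj (expWave a x) = expWave (-a) x := by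
  rw [expWave, expWave, ← Complex.exp_conj]
  congr 1
  simp only [map_mul, conj_ofReal, conj_I, ofReal_neg, map_ofNat]
  ring

/-- With $b=\beta m$, the translated $\hat g$ lives in $(b,b+1]\subset(b,b+1/\alpha]$. Up to a
factor $\alpha$ and a unimodular phase, the inner products are the Fourier coefficients of
$\overline{\hat g(\cdot-b)}\,\varphi$ on the larger interval, so Parseval applies. -/
theorem hasSum_sq_inner_freqAtom {w α β : ℝ} (hα : 0 < α) (hα1 : α < 1) (m : ℤ)
    (φ : Lp ℂ 2 (volume : Measure ℝ)) :
    HasSum (fun n : ℤ => ‖inner ℂ ((memLp_freqAtom w α β (m, n) 2).toLp _) φ‖ ^ 2)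
      (∫ ξ, freqMultiplier w α (β * m) ξ * ‖φ ξ‖ ^ 2) := by
  set b : ℝ := β * m with hb
  set T : ℝ → ℂ := fun ξ => truncExp (-(2 * Real.pi * I)) (2 * Real.pi * w) (ξ - b) with hT
  have hα1' : 1 < α⁻¹ := (one_lt_inv₀ hα).2 hα1
  have hab : b < b + α⁻¹ := by linarith
  set ψ : ℝ → ℂ := fun ξ => conj (T ξ) * φ ξ with hψ
  have hTsupp : ∀ ξ, ξ ∉ Set.Ioc b (b + α⁻¹) → T ξ = 0 := fun ξ hξ => by
    simp only [hT, truncExp]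
    refine Set.indicator_of_notMem (fun h => hξ ⟨?_, ?_⟩) _
    · linarith [h.1]
    · linarith [h.2]
  have hTtop : MemLp T ∞ volume := (memLp_truncExp _ _ ∞).comp_measurePreserving
    (measurePreserving_sub_right volume b)
  have hψ2 : MemLp ψ 2 volume := (Lp.memLp φ).mul' hTtop.star
  have hsum := hasSum_sq_fourierCoeffOn hab (hψ2.mono_measure Measure.restrict_le_self)
  have hba : b + α⁻¹ - b = α⁻¹ := by ring
  have hint : ∫ ξ in b..(b + α⁻¹), ‖ψ ξ‖ ^ 2 = ∫ ξ, ‖T ξ‖ ^ 2 * ‖φ ξ‖ ^ 2 := by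
    rw [intervalIntegral.integral_of_le hab.le, setIntegral_eq_integral_of_forall_compl_eq_zero]
    · refine integral_congr_ae (Filter.Eventually.of_forall fun ξ => ?_)
      simp only [hψ, norm_mul, RCLike.norm_conj, mul_pow]
    · intro ξ hξ
      simp [hψ, hTsupp ξ hξ]
  -- The index is `-n` because conjugating the atom gives $e^{+2\pi i\alpha n\xi}$, while a Fourier
  -- coefficient integrates against the conjugate character.
  have hcoef : ∀ n : ℤ, ‖fourierCoeffOn hab ψ (-n)‖ ^ 2 =
      α ^ 2 * ‖inner ℂ ((memLp_freqAtom w α β (m, n) 2).toLp _) φ‖ ^ 2 := fun n => by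
    have h1 : inner ℂ ((memLp_freqAtom w α β (m, n) 2).toLp _) φ =
        ∫ ξ, expWave (α * n) (ξ - b) * ψ ξ := by
      rw [L2.inner_def]
      refine integral_congr_ae ?_
      filter_upwards [(memLp_freqAtom w α β (m, n) 2).coeFn_toLp] with ξ hξ
      rw [hξ, RCLike.inner_apply, freqAtom, map_mul, conj_expWave, neg_neg, ← mul_assoc,
        mul_comm]
      simp only [hψ, hT]
      ring
    have h2 : fourierCoeffOn hab ψ (-n) = α * (expWave (α * n) b *
        ∫ ξ, expWave (α * n) (ξ - b) * ψ ξ) := by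
      rw [fourierCoeffOn_eq_integral, intervalIntegral.integral_of_le hab.le,
        setIntegral_eq_integral_of_forall_compl_eq_zero, ← integral_const_mul, neg_neg]
      · have h0 : 1 / (b + α⁻¹ - b) = α := by rw [hba, one_div, inv_inv]
        rw [h0, Complex.real_smul]
        congr 1
        refine integral_congr_ae (Filter.Eventually.of_forall fun ξ => ?_)
        have h3 : fourier n (ξ : AddCircle (b + α⁻¹ - b)) =
            expWave (α * n) b * expWave (α * n) (ξ - b) := by
          rw [← expWave_add_right, add_sub_cancel, fourier_coe_apply, hba, expWave]
          congr 1
          push_cast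
          rw [div_inv_eq_mul]
          ring
        simp only [h3, smul_eq_mul, mul_assoc]
      · intro ξ hξ
        simp [hψ, hTsupp ξ hξ]
    rw [h2, h1, norm_mul, norm_mul, norm_expWave, mul_pow]
    simp
  have h3 := (Equiv.neg ℤ).hasSum_iff.2 hsum
  simp only [Function.comp_def, Equiv.neg_apply, hcoef, hba, inv_inv, hint] at h3
  have h4 := h3.mul_left (α ^ 2)⁻¹
  have h5 : ∫ ξ, freqMultiplier w α b ξ * ‖φ ξ‖ ^ 2 =
      (α ^ 2)⁻¹ * α • ∫ ξ, ‖T ξ‖ ^ 2 * ‖φ ξ‖ ^ 2 := by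
    have h6 : ∀ ξ, freqMultiplier w α b ξ * ‖φ ξ‖ ^ 2 = α⁻¹ * (‖T ξ‖ ^ 2 * ‖φ ξ‖ ^ 2) :=
      fun ξ => mul_assoc _ _ _
    simp only [h6]
    rw [integral_const_mul, smul_eq_mul, ← mul_assoc]
    congr 1
    field_simp
  rw [h5]
  simpa only [inv_mul_cancel_left₀ (pow_ne_zero 2 hα.ne')] using h4

/-- Squaring the modulus doubles the rate $2\pi w$ and turns $-2\pi i$ into $4\pi^2$. The constant
is written as $2\pi i\cdot(-2\pi i/\alpha)$ to fit `fourierInv_truncExp_eq_sincKernel`. -/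
theorem truncExp_four_pi (w α ξ : ℝ) :
    truncExp (2 * Real.pi * I * -(2 * Real.pi * I / α)) (4 * Real.pi * w) ξ =
      ((α⁻¹ * ‖truncExp (-(2 * Real.pi * I)) (2 * Real.pi * w) ξ‖ ^ 2 : ℝ) : ℂ) := by
  by_cases hξ : ξ ∈ Set.Ioc (0 : ℝ) 1
  · simp only [truncExp, Set.indicator_of_mem hξ]
    rw [← ofReal_mul, ← ofReal_mul, norm_mul, norm_exp_ofReal, mul_pow, ← Real.exp_nat_mul]
    have h1 : ‖(-(2 * Real.pi * I) : ℂ)‖ ^ 2 = 4 * Real.pi ^ 2 := by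
      rw [norm_neg, norm_mul, norm_mul, norm_I, norm_real, Real.norm_of_nonneg Real.pi_pos.le]
      norm_num
      ring
    rw [h1]
    have h2 : ((2 : ℕ) : ℝ) * (2 * Real.pi * w * ξ) = 4 * Real.pi * w * ξ := by
      push_cast
      ring
    rw [h2]
    push_cast
    linear_combination (-(4 * Real.pi ^ 2 / α) * cexp (4 * Real.pi * w * ξ) : ℂ) * I_sq
  · simp only [truncExp, Set.indicator_of_notMem hξ]
    simp

/-! ### Bessel bound for the full system and multiplication operators -/

theorem sum_indicator_Ioc_le {β : ℝ} (hβ : 0 < β) (ξ : ℝ) (t : Finset ℤ) :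
    ∑ m ∈ t, (Set.Ioc (0 : ℝ) 1).indicator (fun _ => (1 : ℝ)) (ξ - β * m) ≤ β⁻¹ + 1 := by
  classical
  simp only [Set.indicator_apply]
  rw [Finset.sum_boole]
  -- The admissible $m$ lie in an interval of length $1/\beta$, which holds at most $1/\beta+1$
  -- integers.
  have hsub : (t.filter fun m : ℤ => ξ - β * m ∈ Set.Ioc (0 : ℝ) 1) ⊆
      Finset.Icc ⌈(ξ - 1) / β⌉ ⌊ξ / β⌋ := by
    intro m hm
    obtain ⟨-, h1, h2⟩ := Finset.mem_filter.1 hm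
    rw [Finset.mem_Icc, Int.ceil_le, Int.le_floor, div_le_iff₀ hβ, le_div_iff₀ hβ]
    constructor <;> linarith
  have hcard := Finset.card_le_card hsub
  rw [Int.card_Icc] at hcard
  have h1 := Int.le_ceil ((ξ - 1) / β)
  have h2 := Int.floor_le (ξ / β)
  have h3 : (ξ - 1) / β = ξ / β - β⁻¹ := by field_simp
  have h4 : ((⌊ξ / β⌋ + 1 - ⌈(ξ - 1) / β⌉).toNat : ℝ) ≤ β⁻¹ + 1 := by
    rcases le_total 0 (⌊ξ / β⌋ + 1 - ⌈(ξ - 1) / β⌉) with h | h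
    · have : ((⌊ξ / β⌋ + 1 - ⌈(ξ - 1) / β⌉).toNat : ℝ)
          = ((⌊ξ / β⌋ + 1 - ⌈(ξ - 1) / β⌉ : ℤ) : ℝ) := by
        exact_mod_cast Int.toNat_of_nonneg h
      rw [this]
      push_cast
      linarith
    · rw [Int.toNat_of_nonpos h]
      simp
      positivity
  exact le_trans (by exact_mod_cast hcard) h4

theorem freqMultiplier_nonneg {w α b : ℝ} (hα : 0 < α) (ξ : ℝ) : 0 ≤ freqMultiplier w α b ξ := by
  unfold freqMultiplier
  positivity

theorem freqMultiplier_le {w α b : ℝ} (hα : 0 < α) (ξ : ℝ) :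
    freqMultiplier w α b ξ ≤ α⁻¹ * (‖(-(2 * Real.pi * I) : ℂ)‖ * Real.exp |2 * Real.pi * w|) ^ 2 *
      (Set.Ioc (0 : ℝ) 1).indicator (fun _ => (1 : ℝ)) (ξ - b) := by
  have h := norm_truncExp_le (-(2 * Real.pi * I)) (2 * Real.pi * w) (ξ - b)
  rw [freqMultiplier, mul_assoc α⁻¹]
  refine mul_le_mul_of_nonneg_left ?_ (inv_nonneg.2 hα.le)
  by_cases hξ : ξ - b ∈ Set.Ioc (0 : ℝ) 1
  · simp only [Set.indicator_of_mem hξ] at h ⊢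
    rw [mul_one]
    gcongr
  · simp only [Set.indicator_of_notMem hξ] at h ⊢
    rw [le_antisymm h (norm_nonneg _)]
    simp

theorem measurable_freqMultiplier (w α b : ℝ) : Measurable (freqMultiplier w α b) :=
  (((measurable_truncExp _ _).comp (measurable_id.sub measurable_const)).norm.pow_const 2).const_mul _

theorem memLp_freqMultiplier (w α b : ℝ) :
    MemLp (fun ξ => (freqMultiplier w α b ξ : ℂ)) ∞ volume := by
  have h := (memLp_truncExp (2 * Real.pi * I * -(2 * Real.pi * I / α)) (4 * Real.pi * w)
    ∞).comp_measurePreserving (measurePreserving_sub_right volume b)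
  have h2 : (fun ξ => (freqMultiplier w α b ξ : ℂ)) = _ :=
    funext fun ξ => (truncExp_four_pi w α (ξ - b)).symm
  rw [h2]
  exact h

theorem isBesselWith_freqAtom {w α β : ℝ} (hα : 0 < α) (hα1 : α < 1) (hβ : 0 < β) :
    IsBesselWith (fun p : ℤ × ℤ => (memLp_freqAtom w α β p 2).toLp _)
      (α⁻¹ * (‖(-(2 * Real.pi * I) : ℂ)‖ * Real.exp |2 * Real.pi * w|) ^ 2 * (β⁻¹ + 1)) := by
  classical
  refine ⟨by positivity, fun φ s => ?_⟩
  set K := α⁻¹ * (‖(-(2 * Real.pi * I) : ℂ)‖ * Real.exp |2 * Real.pi * w|) ^ 2 with hK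
  have hK0 : 0 ≤ K := by positivity
  have hint : ∀ m : ℤ, Integrable fun ξ => freqMultiplier w α (β * m) ξ * ‖φ ξ‖ ^ 2 := fun m => by
    refine (integrable_norm_sq φ).bdd_mul (c := K)
      (measurable_freqMultiplier w α _).aestronglyMeasurable
      (Filter.Eventually.of_forall fun ξ => ?_)
    rw [Real.norm_of_nonneg (freqMultiplier_nonneg hα ξ)]
    refine (freqMultiplier_le hα ξ).trans (mul_le_of_le_one_right hK0 ?_)
    exact Set.indicator_le_self' (fun _ _ => zero_le_one) _
  -- Enlarging the finite index set to a rectangle lets Parseval bound each row; the overlap count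
  -- then bounds the sum of the multipliers pointwise.
  calc ∑ p ∈ s, ‖inner ℂ ((memLp_freqAtom w α β p 2).toLp _) φ‖ ^ 2
      ≤ ∑ p ∈ (s.image Prod.fst) ×ˢ (s.image Prod.snd),
          ‖inner ℂ ((memLp_freqAtom w α β p 2).toLp _) φ‖ ^ 2 :=
        Finset.sum_le_sum_of_subset_of_nonneg Finset.subset_product (fun _ _ _ => by positivity)
    _ = ∑ m ∈ s.image Prod.fst, ∑ n ∈ s.image Prod.snd,
          ‖inner ℂ ((memLp_freqAtom w α β (m, n) 2).toLp _) φ‖ ^ 2 := Finset.sum_product _ _ _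
    _ ≤ ∑ m ∈ s.image Prod.fst, ∫ ξ, freqMultiplier w α (β * m) ξ * ‖φ ξ‖ ^ 2 :=
        Finset.sum_le_sum fun m _ => sum_le_hasSum _ (fun _ _ => by positivity)
          (hasSum_sq_inner_freqAtom hα hα1 m φ)
    _ = ∫ ξ, (∑ m ∈ s.image Prod.fst, freqMultiplier w α (β * m) ξ) * ‖φ ξ‖ ^ 2 := by
        rw [← integral_finsetSum _ fun m _ => hint m]
        simp only [Finset.sum_mul]
    _ ≤ ∫ ξ, (K * (β⁻¹ + 1)) * ‖φ ξ‖ ^ 2 := by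
        refine integral_mono ?_ ((integrable_norm_sq φ).const_mul _) fun ξ => ?_
        · simp only [Finset.sum_mul]
          exact integrable_finsetSum _ fun m _ => hint m
        · refine mul_le_mul_of_nonneg_right ?_ (by positivity)
          calc _ ≤ ∑ m ∈ s.image Prod.fst, K *
                (Set.Ioc (0 : ℝ) 1).indicator (fun _ => (1 : ℝ)) (ξ - β * m) :=
              Finset.sum_le_sum fun m _ => freqMultiplier_le hα ξ
            _ = K * ∑ m ∈ s.image Prod.fst,
                (Set.Ioc (0 : ℝ) 1).indicator (fun _ => (1 : ℝ)) (ξ - β * m) := by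
              rw [Finset.mul_sum]
            _ ≤ _ := mul_le_mul_of_nonneg_left (sum_indicator_Ioc_le hβ ξ _) hK0
    _ = _ := by rw [integral_const_mul, integral_norm_sq_eq_norm_sq]

/-- Multiplication by a bounded function on `L²`. -/
theorem exists_mulOperator {ρ : ℝ → ℂ} (hρ : MemLp ρ ∞ volume) :
    ∃ D : Lp ℂ 2 (volume : Measure ℝ) →L[ℂ] Lp ℂ 2 (volume : Measure ℝ),
      ∀ φ, D φ =ᵐ[volume] fun ξ => ρ ξ * φ ξ := by
  refine ⟨(ContinuousLinearMap.mul ℂ ℂ).holderL volume ∞ 2 2 (hρ.toLp ρ), fun φ => ?_⟩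
  rw [ContinuousLinearMap.holderL_apply_apply]
  filter_upwards [(ContinuousLinearMap.mul ℂ ℂ).coeFn_holder (r := 2) (hρ.toLp ρ) φ,
    hρ.coeFn_toLp] with ξ h1 h2
  rw [h1, h2, ContinuousLinearMap.mul_apply']

/-- For fixed `m`, the frame operator of the atoms is multiplication by `|ĝ(ξ - β m)|² / α`. -/
theorem exists_hasSum_freqAtom {w α β : ℝ} (hα : 0 < α) (hα1 : α < 1) (m : ℤ)
    (φ : Lp ℂ 2 (volume : Measure ℝ)) :
    ∃ ψ : Lp ℂ 2 (volume : Measure ℝ),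
      ψ =ᵐ[volume] (fun ξ => (freqMultiplier w α (β * m) ξ : ℂ) * φ ξ) ∧
      HasSum (fun n : ℤ => inner ℂ ((memLp_freqAtom w α β (m, n) 2).toLp _) φ •
        (memLp_freqAtom w α β (m, n) 2).toLp _) ψ := by
  obtain ⟨D, hD⟩ := exists_mulOperator (memLp_freqMultiplier w α (β * m))
  refine ⟨D φ, hD φ, hasSum_inner_smul_of_hasSum_sq D (fun f => ?_) φ⟩
  have h := Complex.hasSum_ofReal.2 (hasSum_sq_inner_freqAtom (w := w) (β := β) hα hα1 m f)
  convert h using 1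
  rw [L2.inner_def, ← integral_complex_ofReal]
  refine integral_congr_ae ?_
  filter_upwards [hD f] with ξ hξ
  rw [hξ, RCLike.inner_apply]
  simp only [ofReal_mul, ofReal_pow]
  rw [mul_assoc]
  congr 1
  rw [mul_conj, normSq_eq_norm_sq]
  simp

/-! ### The frame operator as a convolution -/

theorem fourierInv_freqMultiplier {w : ℝ} (hw : w ≠ 0) (α b s : ℝ) :
    𝓕⁻ (fun ξ => (freqMultiplier w α b ξ : ℂ)) s =
      -(2 * Real.pi * I / α) * (expWave b s * sincKernel w s) := by
  have h : (fun ξ => (freqMultiplier w α b ξ : ℂ)) = fun ξ =>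
      truncExp (2 * Real.pi * I * -(2 * Real.pi * I / α)) (4 * Real.pi * w) (ξ - b) :=
    funext fun ξ => (truncExp_four_pi w α (ξ - b)).symm
  rw [h, fourierInv_comp_sub, fourierInv_truncExp_eq_sincKernel hw]
  ring

theorem integrable_freqMultiplier (w α b : ℝ) :
    Integrable fun ξ => (freqMultiplier w α b ξ : ℂ) := by
  have h := (memLp_truncExp (2 * Real.pi * I * -(2 * Real.pi * I / α)) (4 * Real.pi * w)
    1).comp_measurePreserving (measurePreserving_sub_right volume b)
  have h2 : (fun ξ => (freqMultiplier w α b ξ : ℂ)) = _ :=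
    funext fun ξ => (truncExp_four_pi w α (ξ - b)).symm
  rw [h2]
  exact memLp_one_iff_integrable.1 h

theorem fourierInv_comp_const_sub (f : ℝ → ℂ) (x ξ : ℝ) :
    𝓕⁻ (fun s => f (x - s)) ξ = expWave x ξ * 𝓕 f ξ := by
  rw [fourierInv_eq_integral_expWave, fourier_eq_integral_expWave, ← integral_const_mul,
    ← integral_sub_left_eq_self _ volume x]
  refine integral_congr_ae (Filter.Eventually.of_forall fun s => ?_)
  simp only [sub_sub_cancel]
  rw [sub_eq_add_neg, expWave_add_right, expWave_comm ξ x, expWave_comm ξ (-s), expWave_comm (-ξ) s]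
  simp only [expWave]
  push_cast
  ring_nf

/-- Since $e^{2\pi ix\xi}\hat f(\xi)$ is the inverse transform of $f(x-\cdot)$, the multiplication
formula moves that transform onto the multiplier, where it is explicit. -/
theorem fourierInv_freqMultiplier_mul_fourier {w : ℝ} (hw : w ≠ 0) (α b : ℝ) (f : 𝓢(ℝ, ℂ))
    (x : ℝ) :
    𝓕⁻ (fun ξ => (freqMultiplier w α b ξ : ℂ) * 𝓕 (⇑f) ξ) x =
      -(2 * Real.pi * I / α) * ∫ s, sincKernel w s * f (x - s) * expWave b s := by
  have h := integral_fourierInv_mul_eq_of_integrable (integrable_freqMultiplier w α b)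
    (f.integrable.comp_sub_left x)
  rw [fourierInv_eq_integral_expWave, ← integral_const_mul]
  refine Eq.trans ?_ (h.symm.trans ?_)
  · refine integral_congr_ae (Filter.Eventually.of_forall fun ξ => ?_)
    simp only [fourierInv_comp_const_sub]
    ring
  · refine integral_congr_ae (Filter.Eventually.of_forall fun s => ?_)
    simp only [fourierInv_freqMultiplier hw]
    ring

/-- A series that converges in `L²` and pointwise has the same sum in both senses. -/
theorem ae_eq_of_hasSum_Lp {ι : Type*} [Countable ι] {v : ι → Lp ℂ 2 (volume : Measure ℝ)}
    {V : Lp ℂ 2 (volume : Measure ℝ)} (hV : HasSum v V) {u : ι → ℝ → ℂ} {U : ℝ → ℂ}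
    (hu : ∀ i, v i =ᵐ[volume] u i) (hU : ∀ x, HasSum (fun i => u i x) (U x)) :
    V =ᵐ[volume] U := by
  -- Convergence in $L^2$ gives convergence in measure, hence almost everywhere along some sequence
  -- of finite sets tending to `atTop`; the pointwise sums converge along the same sequence.
  have h1 := tendstoInMeasure_of_tendsto_Lp (l := Filter.atTop) hV
  obtain ⟨ns, hns, h2⟩ := h1.exists_seq_tendsto_ae'
  have h3 : ∀ᵐ x, ∀ i, v i x = u i x := ae_all_iff.2 hu
  have h4 : ∀ᵐ x, ∀ n, (∑ i ∈ ns n, v i : Lp ℂ 2 (volume : Measure ℝ)) x =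
      ∑ i ∈ ns n, v i x := ae_all_iff.2 fun n => Lp.coeFn_fun_finsetSum (ns n) v
  filter_upwards [h2, h3, h4] with x hx2 hx3 hx4
  refine tendsto_nhds_unique hx2 ?_
  have h5 := (hU x).comp hns
  refine h5.congr fun n => ?_
  rw [hx4]
  exact Finset.sum_congr rfl fun i _ => (hx3 i).symm

/-- A bounded multiplier times the Schwartz function $\hat f$ is in $L^1\cap L^2$, so its $L^2$
inverse transform is the explicit integral. -/
theorem coeFn_fourierInv_freqMultiplier {w : ℝ} (hw : w ≠ 0) (α b : ℝ) (f : 𝓢(ℝ, ℂ))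
    (ψ : Lp ℂ 2 (volume : Measure ℝ))
    (hψ : ψ =ᵐ[volume] fun ξ => (freqMultiplier w α b ξ : ℂ) * (𝓕 f).toLp 2 volume ξ) :
    (𝓕⁻ ψ : Lp ℂ 2 (volume : Measure ℝ)) =ᵐ[volume] fun x =>
      -(2 * Real.pi * I / α) * ∫ s, sincKernel w s * f (x - s) * expWave b s := by
  have h1 : ψ =ᵐ[volume] fun ξ => (freqMultiplier w α b ξ : ℂ) * 𝓕 (⇑f) ξ := by
    filter_upwards [hψ, (𝓕 f).coeFn_toLp 2 volume] with ξ h h'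
    rw [h, h', SchwartzMap.fourier_coe]
  have h2 : MemLp (fun ξ => (freqMultiplier w α b ξ : ℂ) * 𝓕 (⇑f) ξ) 2 volume :=
    (memLp_congr_ae h1).1 (Lp.memLp ψ)
  have h3 : Integrable fun ξ => (freqMultiplier w α b ξ : ℂ) * 𝓕 (⇑f) ξ := by
    rw [← memLp_one_iff_integrable, ← SchwartzMap.fourier_coe]
    exact ((𝓕 f).memLp 1 volume).mul' (memLp_freqMultiplier w α b)
  have h4 : ψ = h2.toLp _ := Lp.ext (h1.trans h2.coeFn_toLp.symm)
  rw [h4]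
  refine (coeFn_fourierInv_toLp h3 h2).trans (Filter.Eventually.of_forall fun x => ?_)
  exact fourierInv_freqMultiplier_mul_fourier hw α b f x

theorem mainTheorem5 (α β w : ℝ) (hα : 0 < α) (hα1 : α < 1) (hβ : 0 < β) (hw : w ≠ 0) :
    Summable (fun m : ℤ => expWaveDist (m * β)) ∧
    ∃ S : Lp ℂ 2 (volume : Measure ℝ) →L[ℂ] Lp ℂ 2 (volume : Measure ℝ),
      IsGaborFrameOperator (sincWindow w) (memLp_sincWindow hw) α β S ∧
      ∀ f : 𝓢(ℝ, ℂ),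
        (S (f.toLp 2 volume) : ℝ → ℂ) =ᵐ[volume]
          fun x => -(2 * Real.pi * I / α) * schwartzConv f (hThree w β) x := by
  refine ⟨summable_expWaveDist hβ, ?_⟩
  obtain ⟨S, hS⟩ := (isBesselWith_freqAtom (w := w) hα hα1 hβ).exists_frameOperator
  let F : Lp ℂ 2 (volume : Measure ℝ) ≃L[ℂ] Lp ℂ 2 (volume : Measure ℝ) :=
    (Lp.fourierTransformₗᵢ ℝ ℂ).toContinuousLinearEquiv
  -- The frame operator is the frequency-side one conjugated by the unitary Fourier transform, which
  -- carries the Gabor atoms to the `freqAtom`s.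
  refine ⟨(F.symm : _ →L[ℂ] _).comp (S.comp (F : _ →L[ℂ] _)), fun f => ?_, fun f => ?_⟩
  · have h := (hS (F f)).mapL F.symm.toContinuousLinearMap
    have h3 : (fun p : ℤ × ℤ => F.symm.toContinuousLinearMap
        (inner ℂ ((memLp_freqAtom w α β p 2).toLp _) (F f) • (memLp_freqAtom w α β p 2).toLp _)) =
        fun p => inner ℂ (gaborAtom (sincWindow w) (memLp_sincWindow hw) α β p) f •
          gaborAtom (sincWindow w) (memLp_sincWindow hw) α β p := by
      funext p
      have h1 : F.symm ((memLp_freqAtom w α β p 2).toLp _) =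
          gaborAtom (sincWindow w) (memLp_sincWindow hw) α β p :=
        fourierInv_toLp_freqAtom hw α β p
      have h2 : inner ℂ ((memLp_freqAtom w α β p 2).toLp _) (F f) =
          inner ℂ (gaborAtom (sincWindow w) (memLp_sincWindow hw) α β p) f := by
        rw [← F.apply_symm_apply ((memLp_freqAtom w α β p 2).toLp _), h1]
        exact Lp.inner_fourier_eq _ _
      rw [map_smul, ContinuousLinearEquiv.coe_coe, h1, h2]
    rw [← h3]
    exact h
  · have hF : F (f.toLp 2 volume) = (𝓕 f).toLp 2 volume := SchwartzMap.toLp_fourier_eq f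
    have hsum := hS ((𝓕 f).toLp 2 volume)
    choose ψ hψ hψsum using fun m : ℤ =>
      exists_hasSum_freqAtom (w := w) (β := β) hα hα1 m ((𝓕 f).toLp 2 volume)
    -- Unconditional convergence permits summing over $n$ first, leaving a series over $m$ of
    -- multiplier terms that still converges in $L^2$.
    have h1 := (hsum.prod_fiberwise hψsum).mapL F.symm.toContinuousLinearMap
    have h2 : ((F.symm : _ →L[ℂ] _).comp (S.comp (F : _ →L[ℂ] _))) (f.toLp 2 volume) =
        F.symm (S ((𝓕 f).toLp 2 volume)) := by
      rw [← hF]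
      rfl
    rw [h2]
    refine ae_eq_of_hasSum_Lp h1 (fun m =>
      coeFn_fourierInv_freqMultiplier hw α (β * m) f (ψ m) (hψ m)) fun x => ?_
    have h3 := (hasSum_schwartzConv_hThree hw hβ f x).mul_left (-(2 * Real.pi * I / α) : ℂ)
    simpa only [mul_comm β] using h3
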